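/- Let $\mathcal{A}$ be a unital complex Banach algebra. An element $a\in\mathcal{A}$ is called Drazin invertible if there is $b\in\mathcal{A}$ with $ab=ba$, $bab=b$ and $(a(1-ab))^n=0$ for some $n\in\mathbb{N}$. Let $$\mathcal{M}=\{(\alpha_1,\alpha_2,0):\alpha_1,\alpha_2\in\mathbb{C},\ \alpha_1\alpha_2\neq0\}\cup\{(\alpha_1,0,0):\alpha_1\in\mathbb{C}\setminus\{0\}\}.$$ Suppose $x_1,x_2,x_3\in\mathcal{A}$ and $(\alpha_1,\alpha_2,\beta)\in\mathbb{C}^3\setminus\mathcal{M}$ satisfy $$x_1x_2+x_1x_3+x_2x_3=\alpha_1 1+\alpha_2(x_1+x_2+x_3)\quad\text{and}\quad x_1x_2x_3=\beta(x_1+x_2+x_3).$$ Then, if any three of the four elements $x_1$, $x_2$, $x_3$, $x_1+x_2+x_3$ are Drazin invertible, so is the remaining one. -/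

import Mathlib

/-- `b` is a Drazin inverse of `a`: `ab = ba`, `bab = b`, and `a(1 - ab)` is nilpotent. -/
def IsDrazinInverse {A : Type*} [Ring A] (a b : A) : Prop :=
  a * b = b * a ∧ b * a * b = b ∧ ∃ n : ℕ, (a * (1 - a * b)) ^ n = 0

/-- `a` is Drazin invertible: it has a Drazin inverse in the ring. -/
def IsDrazinInvertible {A : Type*} [Ring A] (a : A) : Prop :=
  ∃ b : A, IsDrazinInverse a b

/-- The exceptional set of parameters `(α₁, α₂, β)`. -/
def exceptionalSet : Set (ℂ × ℂ × ℂ) :=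
  {p | ∃ α₁ α₂ : ℂ, α₁ * α₂ ≠ 0 ∧ p = (α₁, α₂, 0)} ∪ {p | ∃ α₁ : ℂ, α₁ ≠ 0 ∧ p = (α₁, 0, 0)}

/-! An element `a` is Drazin invertible iff its resolvent has at most a pole at `0`; algebraically,
iff `X - a` is a unit of the Laurent series ring over `A`. The same holds with `X` replaced by any
nonzero scalar series `f` without constant term. Put `s = x₁ + x₂ + x₃` and `q = X² - α₂X + β`. The
hypotheses give `(X - x₁)(X - x₂)(X - x₃) = X³ + α₁X - q s = q (f - s)` with `f = (X³ + α₁X) / q`.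
Off the exceptional set `f` is a power series vanishing at `0`, and `q ≠ 0` is a Laurent unit, so
units among three of the four factors force the fourth. No analysis is used. -/

/-- Multiplication by `s * c` fixes `s ^ m`, so `s ^ m * c ^ (m + 1)` is a Drazin inverse, with
idempotent `(s * c) ^ (m + 1)`. -/
theorem isDrazinInvertible_of_pow_eq {R : Type*} [Ring R] {s c : R} (hc : Commute s c) {m : ℕ}
    (h : s ^ m = s ^ (m + 1) * c) : IsDrazinInvertible s := by
  have hy : Commute s (s * c) := (Commute.refl s).mul_right hc
  have hcy : Commute c (s * c) := hc.symm.mul_right (Commute.refl c)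
  have h1 (k : ℕ) : s ^ m * (s * c) ^ k = s ^ m := by
    induction k with
    | zero => simp
    | succ k ih => rw [pow_succ, ← mul_assoc, ih, ← mul_assoc, ← pow_succ, ← h]
  have he : s * (s ^ m * c ^ (m + 1)) = (s * c) ^ (m + 1) := by
    rw [hc.mul_pow, ← mul_assoc, ← pow_succ']
  have hb : Commute s (s ^ m * c ^ (m + 1)) :=
    ((Commute.refl s).pow_right m).mul_right (hc.pow_right _)
  refine ⟨s ^ m * c ^ (m + 1), hb.eq, ?_, m + 1, ?_⟩
  · rw [mul_assoc, he, mul_assoc, (hcy.pow_pow (m + 1) (m + 1)).eq, ← mul_assoc, h1]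
  · rw [he]
    have : Commute s (1 - (s * c) ^ (m + 1)) :=
      (Commute.one_right s).sub_right (hy.pow_right _)
    rw [this.mul_pow, pow_succ' s, mul_assoc, pow_succ' (1 - _), ← mul_assoc (s ^ m), mul_sub, h1]
    simp

section ScalarSeries

open PowerSeries HahnSeries

variable {K A : Type*} [Field K] [Ring A] [Algebra K A]

theorem commute_map_algebraMap_C (f : PowerSeries K) (a : A) :
    Commute (PowerSeries.map (algebraMap K A) f) (PowerSeries.C a) := by
  ext n
  simp only [PowerSeries.coeff_mul_C, PowerSeries.coeff_C_mul, PowerSeries.coeff_map]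
  exact Algebra.commutes _ _

theorem isUnit_ofPowerSeries_X :
    IsUnit (ofPowerSeries ℤ A PowerSeries.X) := by
  rw [ofPowerSeries_X]
  exact ⟨⟨single 1 1, single (-1) 1, by simp, by simp⟩, rfl⟩

theorem isUnit_ofPowerSeries_map {f : PowerSeries K} (hf : f ≠ 0) :
    IsUnit (ofPowerSeries ℤ A (PowerSeries.map (algebraMap K A) f)) := by
  have hu : IsUnit (divXPowOrder f) :=
    IsUnit.of_mul_eq_one _ (Inv_divided_by_X_pow_order_rightInv hf)
  rw [← X_pow_order_mul_divXPowOrder (f := f), map_mul, map_mul, map_pow, map_pow,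
    PowerSeries.map_X]
  exact (isUnit_ofPowerSeries_X.pow _).mul
    (hu.map ((ofPowerSeries ℤ A).comp (PowerSeries.map (algebraMap K A))))

theorem isUnit_of_constantCoeff_eq_one {φ : PowerSeries A} (h : constantCoeff φ = 1) :
    IsUnit φ :=
  ⟨⟨φ, invOfUnit φ 1, mul_invOfUnit φ 1 h, invOfUnit_mul φ 1 h⟩, rfl⟩

/-- Split along the idempotent `p = 1 - a * b`: `a * p` is nilpotent, so `F - a * p` is a unit, and
`1 - b * F` has constant term `1`. Their product is a multiple of `F - a` by a commuting factor. -/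
theorem IsDrazinInvertible.isUnit_map_sub_C {a : A} (ha : IsDrazinInvertible a)
    {f : PowerSeries K} (hf : f ≠ 0) (hf0 : constantCoeff f = 0) :
    IsUnit (ofPowerSeries ℤ A (PowerSeries.map (algebraMap K A) f - PowerSeries.C a)) := by
  obtain ⟨b, hab, hbab, n, hn⟩ := ha
  set F := PowerSeries.map (algebraMap K A) f with hF
  have hFC (x : A) : Commute F (PowerSeries.C x) := commute_map_algebraMap_C f x
  obtain ⟨p, hp⟩ : ∃ p, p = 1 - a * b := ⟨_, rfl⟩
  rw [← hp] at hn
  have habp : Commute a b := hab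
  have hap : Commute a p := hp ▸ (Commute.one_right a).sub_right ((Commute.refl a).mul_right habp)
  have hbp : b * p = 0 := by rw [hp, mul_sub, ← mul_assoc, hbab, mul_one, sub_self]
  have hu : IsUnit (ofPowerSeries ℤ A (F - PowerSeries.C (a * p))) := by
    rw [map_sub, sub_eq_add_neg]
    refine IsNilpotent.isUnit_add_left_of_commute ?_ (isUnit_ofPowerSeries_map hf) ?_
    · refine IsNilpotent.neg ⟨n, ?_⟩
      rw [← map_pow, ← map_pow, hn, map_zero, map_zero]
    · exact ((hFC _).symm.map (ofPowerSeries ℤ A)).neg_left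
  have hv : IsUnit (1 - PowerSeries.C b * F) := by
    apply isUnit_of_constantCoeff_eq_one
    have : constantCoeff F = 0 := by
      rw [hF, ← PowerSeries.coeff_zero_eq_constantCoeff_apply, PowerSeries.coeff_map,
        PowerSeries.coeff_zero_eq_constantCoeff_apply, hf0, map_zero]
    simp [this]
  have key : (F - PowerSeries.C a) * (PowerSeries.C p - PowerSeries.C b * F)
      = (1 - PowerSeries.C b * F) * (F - PowerSeries.C (a * p)) := by
    have e1 : PowerSeries.C b * F * PowerSeries.C (a * p) = 0 := by
      rw [mul_assoc, (hFC _).eq, ← mul_assoc, ← map_mul, ← mul_assoc, ← hab, mul_assoc, hbp]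
      simp
    have e2 : F * PowerSeries.C p = F - PowerSeries.C a * (PowerSeries.C b * F) := by
      rw [(hFC _).eq, hp, map_sub, sub_mul, map_one, one_mul, map_mul, mul_assoc]
    have e3 : F * (PowerSeries.C b * F) = PowerSeries.C b * F * F := by
      rw [← mul_assoc, (hFC _).eq]
    rw [sub_mul, mul_sub, mul_sub, sub_mul, mul_sub, mul_sub, e1, e2, e3, ← map_mul,
      one_mul, one_mul]
    abel
  have hcomm : Commute (F - PowerSeries.C a) (PowerSeries.C p - PowerSeries.C b * F) := by
    have h1 : Commute F (PowerSeries.C p - PowerSeries.C b * F) :=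
      (hFC p).sub_right ((hFC b).mul_right (Commute.refl F))
    have h2 : Commute (PowerSeries.C a) (PowerSeries.C p - PowerSeries.C b * F) :=
      (hap.map PowerSeries.C).sub_right ((habp.map PowerSeries.C).mul_right (hFC a).symm)
    exact h1.sub_left h2
  refine ((hcomm.map (ofPowerSeries ℤ A)).isUnit_mul_iff.1 ?_).1
  rw [← map_mul, key, map_mul]
  exact (hv.map _).mul hu

/-- Clear the pole: `(F - a) * G = X ^ M`. Multiplying by the geometric sum and comparing
coefficients of `X ^ M` gives `a ^ M = -a ^ (M + 1) * G_M`, since `X ^ (M + 1)` divides `F ^ (M +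
1)`. -/
theorem isDrazinInvertible_of_isUnit_map_sub_C {a : A} {f : PowerSeries K}
    (hf0 : constantCoeff f = 0)
    (h : IsUnit (ofPowerSeries ℤ A (PowerSeries.map (algebraMap K A) f - PowerSeries.C a))) :
    IsDrazinInvertible a := by
  set F := PowerSeries.map (algebraMap K A) f with hF
  have hFa : Commute F (PowerSeries.C a) := commute_map_algebraMap_C f a
  obtain ⟨w, hw⟩ := h
  obtain ⟨M, G, hG⟩ : ∃ (M : ℕ) (G : PowerSeries A),
      ofPowerSeries ℤ A G = ofPowerSeries ℤ A (PowerSeries.X ^ M) * ↑w⁻¹ := by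
    set g : LaurentSeries A := ↑w⁻¹
    -- `M` is the order of the pole; it truncates to `0` when there is none, and the extra power of
    -- `X` then restores the positive order.
    refine ⟨(-g.order).toNat, PowerSeries.X ^ (g.order + (-g.order).toNat).toNat *
      LaurentSeries.powerSeriesPart g, ?_⟩
    rw [map_mul, ofPowerSeries_X_pow, ofPowerSeries_X_pow,
      LaurentSeries.ofPowerSeries_powerSeriesPart, ← mul_assoc, single_mul_single, mul_one]
    have e : ((g.order + (-g.order).toNat).toNat : ℤ) + -g.order = (-g.order).toNat := by lia
    rw [e]
  have hX (φ : PowerSeries A) : Commute φ (PowerSeries.X ^ M) := PowerSeries.commute_X_pow φ M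
  have hinj := ofPowerSeries_injective (Γ := ℤ) (R := A)
  have hFG : (F - PowerSeries.C a) * G = PowerSeries.X ^ M := by
    apply hinj
    rw [map_mul, hG, ← mul_assoc, ← map_mul, (hX _).eq, map_mul, mul_assoc, ← hw]
    simp
  have haG : Commute (PowerSeries.C a) G := by
    apply hinj
    rw [map_mul, map_mul, hG]
    have h1 : Commute (ofPowerSeries ℤ A (PowerSeries.C a)) (w : LaurentSeries A) := by
      rw [hw]
      exact (hFa.symm.sub_right (Commute.refl _)).map _
    exact (((hX _).map (ofPowerSeries ℤ A)).mul_right h1.units_inv_right).eq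
  have hac : Commute a (PowerSeries.coeff M G) := by
    have := congrArg (PowerSeries.coeff M) haG.eq
    rwa [PowerSeries.coeff_C_mul, PowerSeries.coeff_mul_C] at this
  have hFX : PowerSeries.X ∣ F := by
    rw [PowerSeries.X_dvd_iff, hF, ← PowerSeries.coeff_zero_eq_constantCoeff_apply,
      PowerSeries.coeff_map, PowerSeries.coeff_zero_eq_constantCoeff_apply, hf0, map_zero]
  obtain ⟨F', hF'⟩ := hFX
  have hFpow (k : ℕ) : F ^ k = PowerSeries.X ^ k * F' ^ k := by
    rw [hF', (PowerSeries.commute_X F').symm.mul_pow]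
  have key : (F ^ (M + 1) - PowerSeries.C a ^ (M + 1)) * G =
      PowerSeries.X ^ M *
        ∑ i ∈ Finset.range (M + 1), F ^ i * PowerSeries.C a ^ (M + 1 - 1 - i) := by
    rw [← hFa.geom_sum₂_mul, mul_assoc, hFG, (hX _).eq]
  have key' := congrArg (PowerSeries.coeff M) key
  have hsum : constantCoeff
      (∑ i ∈ Finset.range (M + 1), F ^ i * PowerSeries.C a ^ (M + 1 - 1 - i)) = a ^ M := by
    rw [map_sum, Finset.sum_range_succ']
    simp [hF', pow_succ]
  have hcoeff := PowerSeries.coeff_X_pow_mul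
    (∑ i ∈ Finset.range (M + 1), F ^ i * PowerSeries.C a ^ (M + 1 - 1 - i)) M 0
  rw [zero_add, PowerSeries.coeff_zero_eq_constantCoeff_apply, hsum] at hcoeff
  rw [hcoeff, sub_mul, map_sub, hFpow, mul_assoc, PowerSeries.coeff_X_pow_mul', if_neg (by lia),
    ← map_pow, PowerSeries.coeff_C_mul, zero_sub] at key'
  refine isDrazinInvertible_of_pow_eq (c := -PowerSeries.coeff M G) hac.neg_right (m := M) ?_
  rw [← key', mul_neg]

theorem isDrazinInvertible_iff_isUnit_map_sub_C {a : A} {f : PowerSeries K} (hf : f ≠ 0)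
    (hf0 : constantCoeff f = 0) : IsDrazinInvertible a ↔
      IsUnit (ofPowerSeries ℤ A (PowerSeries.map (algebraMap K A) f - PowerSeries.C a)) :=
  ⟨fun h => h.isUnit_map_sub_C hf hf0, isDrazinInvertible_of_isUnit_map_sub_C hf0⟩

theorem isDrazinInvertible_iff_isUnit_X_sub_C (K : Type*) {A : Type*} [Field K] [Ring A]
    [Algebra K A] {a : A} : IsDrazinInvertible a ↔
    IsUnit (ofPowerSeries ℤ A (PowerSeries.X - PowerSeries.C a)) := by
  have h := isDrazinInvertible_iff_isUnit_map_sub_C (K := K) (a := a) (f := PowerSeries.X)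
    PowerSeries.X_ne_zero PowerSeries.constantCoeff_X
  rwa [PowerSeries.map_X] at h

end ScalarSeries

theorem Commute.sub_mul_sub_mul_sub {R : Type*} [Ring R] {t a b c : R} (ha : Commute t a)
    (hb : Commute t b) :
    (t - a) * (t - b) * (t - c) =
      t ^ 3 - t ^ 2 * (a + b + c) + t * (a * b + a * c + b * c) - a * b * c := by
  have e1 : a * t = t * a := ha.eq.symm
  have e2 : b * t = t * b := hb.eq.symm
  have e4 : a * (t * b) = t * (a * b) := by rw [← mul_assoc, e1, mul_assoc]
  simp only [sub_mul, mul_sub, mul_add, pow_succ, pow_zero, one_mul, mul_assoc, e1, e2, e4]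
  abel

section Units

variable {M : Type*} [Monoid M] {a b c : M}

theorem IsUnit.right_of_mul (ha : IsUnit a) (h : IsUnit (a * b)) : IsUnit b := by
  obtain ⟨u, rfl⟩ := ha
  exact (Units.isUnit_units_mul u b).1 h

theorem IsUnit.left_of_mul (hb : IsUnit b) (h : IsUnit (a * b)) : IsUnit a := by
  obtain ⟨u, rfl⟩ := hb
  exact (Units.isUnit_mul_units a u).1 h

end Units

open PowerSeries in
-- If `β ≠ 0` the quadratic is invertible; otherwise `α₁ = 0` and powers of `X` cancel, leaving `X²
-- / (X - α₂)`, or `X` if `α₂ = 0`.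
theorem exists_mul_eq_X_pow_three_add {K : Type*} [Field K] {α₁ α₂ β : K}
    (h : β = 0 → α₁ = 0) :
    ∃ f : PowerSeries K, f ≠ 0 ∧ constantCoeff f = 0 ∧
      (X ^ 2 - C α₂ * X + C β) * f = X ^ 3 + C α₁ * X := by
  have hne : (X ^ 3 + C α₁ * X : PowerSeries K) ≠ 0 := fun h0 => by
    simpa [coeff_X, coeff_X_pow, coeff_C_mul] using congrArg (coeff 3) h0
  suffices ∃ f : PowerSeries K, constantCoeff f = 0 ∧
      (X ^ 2 - C α₂ * X + C β) * f = X ^ 3 + C α₁ * X by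
    obtain ⟨f, hf0, hf⟩ := this
    refine ⟨f, ?_, hf0, hf⟩
    rintro rfl
    exact hne (by rw [← hf, mul_zero])
  by_cases hβ : β = 0
  · obtain rfl := h hβ
    subst hβ
    by_cases hα : α₂ = 0
    · subst hα
      exact ⟨X, by simp, by simp; ring⟩
    · refine ⟨X ^ 2 * (X - C α₂)⁻¹, by simp, ?_⟩
      have hc := PowerSeries.mul_inv_cancel (X - C α₂ : PowerSeries K) (by simpa using hα)
      simp only [map_zero, add_zero, zero_mul]
      linear_combination X ^ 3 * hc
  · refine ⟨(X ^ 3 + C α₁ * X) * (X ^ 2 - C α₂ * X + C β)⁻¹, by simp, ?_⟩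
    have hc := PowerSeries.mul_inv_cancel (X ^ 2 - C α₂ * X + C β : PowerSeries K)
      (by simpa using hβ)
    linear_combination (X ^ 3 + C α₁ * X) * hc

theorem prod_X_sub_C_eq {K A : Type*} [Field K] [Ring A] [Algebra K A]
    {x₁ x₂ x₃ : A} {α₁ α₂ β : K} {f : PowerSeries K}
    (h₂ : x₁ * x₂ + x₁ * x₃ + x₂ * x₃ = algebraMap K A α₁ + α₂ • (x₁ + x₂ + x₃))
    (h₃ : x₁ * x₂ * x₃ = β • (x₁ + x₂ + x₃))
    (hf : (PowerSeries.X ^ 2 - PowerSeries.C α₂ * PowerSeries.X + PowerSeries.C β) * f =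
      PowerSeries.X ^ 3 + PowerSeries.C α₁ * PowerSeries.X) :
    (PowerSeries.X - PowerSeries.C x₁) * (PowerSeries.X - PowerSeries.C x₂) *
        (PowerSeries.X - PowerSeries.C x₃) =
      PowerSeries.map (algebraMap K A)
          (PowerSeries.X ^ 2 - PowerSeries.C α₂ * PowerSeries.X + PowerSeries.C β) *
        (PowerSeries.map (algebraMap K A) f - PowerSeries.C (x₁ + x₂ + x₃)) := by
  have hX (x : A) : Commute PowerSeries.X (PowerSeries.C x) := (PowerSeries.commute_X _).symm
  rw [(hX x₁).sub_mul_sub_mul_sub (hX x₂), mul_sub (PowerSeries.map _ _),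
    ← map_mul (PowerSeries.map _), hf]
  simp only [← map_mul, ← map_add]
  rw [h₂, h₃, Algebra.smul_def, Algebra.smul_def]
  generalize x₁ + x₂ + x₃ = s
  simp only [map_add, map_sub, map_mul, map_pow, PowerSeries.map_X, PowerSeries.map_C,
    (hX (algebraMap K A α₂)).left_comm, (hX (algebraMap K A α₁)).eq, mul_add, add_mul, sub_mul, mul_assoc]
  abel

theorem theorem2p3 {A : Type*} [NormedRing A] [NormedAlgebra ℂ A] [CompleteSpace A]
    (x₁ x₂ x₃ : A) (α₁ α₂ β : ℂ)
    (hM : (α₁, α₂, β) ∉ exceptionalSet)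
    (h₂ : x₁ * x₂ + x₁ * x₃ + x₂ * x₃ = algebraMap ℂ A α₁ + α₂ • (x₁ + x₂ + x₃))
    (h₃ : x₁ * x₂ * x₃ = β • (x₁ + x₂ + x₃)) :
    (IsDrazinInvertible x₁ → IsDrazinInvertible x₂ → IsDrazinInvertible x₃ →
      IsDrazinInvertible (x₁ + x₂ + x₃)) ∧
    (IsDrazinInvertible x₁ → IsDrazinInvertible x₂ → IsDrazinInvertible (x₁ + x₂ + x₃) →
      IsDrazinInvertible x₃) ∧
    (IsDrazinInvertible x₁ → IsDrazinInvertible x₃ → IsDrazinInvertible (x₁ + x₂ + x₃) →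
      IsDrazinInvertible x₂) ∧
    (IsDrazinInvertible x₂ → IsDrazinInvertible x₃ → IsDrazinInvertible (x₁ + x₂ + x₃) →
      IsDrazinInvertible x₁) := by
  -- The exceptional set is exactly `β = 0`, `α₁ ≠ 0`.
  have hα : β = 0 → α₁ = 0 := by
    rintro rfl
    by_contra h1
    apply hM
    by_cases h2 : α₂ = 0
    · exact Or.inr ⟨α₁, h1, by rw [h2]⟩
    · exact Or.inl ⟨α₁, α₂, mul_ne_zero h1 h2, rfl⟩
  obtain ⟨f, hfne, hf0, hf⟩ := exists_mul_eq_X_pow_three_add (α₂ := α₂) hα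
  have hq : (PowerSeries.X ^ 2 - PowerSeries.C α₂ * PowerSeries.X + PowerSeries.C β :
      PowerSeries ℂ) ≠ 0 := fun h0 => by
    simpa [PowerSeries.coeff_X, PowerSeries.coeff_X_pow, PowerSeries.coeff_C_mul,
      PowerSeries.coeff_C] using congrArg (PowerSeries.coeff 2) h0
  have hQ := isUnit_ofPowerSeries_map (A := A) hq
  have key := congrArg (HahnSeries.ofPowerSeries ℤ A) (prod_X_sub_C_eq h₂ h₃ hf)
  rw [map_mul, map_mul, map_mul] at key
  rw [isDrazinInvertible_iff_isUnit_map_sub_C (a := x₁ + x₂ + x₃) hfne hf0,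
    isDrazinInvertible_iff_isUnit_X_sub_C ℂ (a := x₁),
    isDrazinInvertible_iff_isUnit_X_sub_C ℂ (a := x₂),
    isDrazinInvertible_iff_isUnit_X_sub_C ℂ (a := x₃)]
  -- The factors need not commute, so known units are cancelled from the outside in.
  refine ⟨fun u₁ u₂ u₃ => ?_, fun u₁ u₂ v => ?_, fun u₁ u₃ v => ?_, fun u₂ u₃ v => ?_⟩
  · exact hQ.right_of_mul (key ▸ (u₁.mul u₂).mul u₃)
  · exact (u₁.mul u₂).right_of_mul (key ▸ hQ.mul v)
  · exact u₁.right_of_mul (u₃.left_of_mul (key ▸ hQ.mul v))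
  · exact u₂.left_of_mul (u₃.left_of_mul (key ▸ hQ.mul v))
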